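/- Throughout, for a countable group $G$, let $\mathcal F(G)$ be the set of nonempty finite subsets of $G$ and $\overline{\mathcal F}(G)$ the set of symmetric finite subsets of $G$ containing the identity. A free p.m.p. action $G\curvearrowright(X,\mu)$ is an action of $G$ by measure-preserving transformations on a standard Borel space $X$ with a probability measure $\mu$ such that, for $\mu$-almost every $x\in X$, $gx\ne x$ for all $g\in G\setminus\{e_G\}$. For $S\subseteq G$, an $S$-edge is a pair $(x,y)$ of points of $X$ such that $y=gx$ for some $g\in S$; a path of length $k$ from $x$ to $y$ is a tuple $(x_0,\dots,x_k)$ with $x_0=x$ and $x_k=y$, whose edges are the pairs $(x_{i-1},x_i)$. A countably infinite group $G$ has property SC if for every function $\Upsilon:\mathcal F(G)\to[0,\infty)$ there exists $S\in\overline{\mathcal F}(G)$ such that for every $T\in\overline{\mathcal F}(G)$ there are $C,n\in\mathbb N$ and $S_1,\dots,S_n\in\overline{\mathcal F}(G)$ such that for every free p.m.p. action $G\curvearrowright(X,\mu)$ there are Borel sets $W,\mathcal V_1,\dots,\mathcal V_n\subseteq X$ satisfying: (i) $\sum_{j=1}^n\Upsilon(S_j)\,\mu(\mathcal V_j)\le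 1$; (ii) $SW=X$; (iii) if $w_1,w_2\in W$ satisfy $gw_1=w_2$ for some $g\in T$, then $w_1$ and $w_2$ are connected by a path of length at most $C$ in which each edge is an $S_j$-edge with both endpoints in $\mathcal V_j$ for some $1\le j\le n$. **Proposition.** Let $G$ be a countable group which has an infinite normal subgroup $N$ with property SC. Then $G$ has property SC. -/

import Mathlib

open scoped NNReal ENNReal Pointwise

/-- A free probability-measure-preserving action of a discrete group `G` on a standard
probability space `(X, μ)`. Freeness means that almost every point is moved by every
nonidentity group element. -/
structure FreePMPAction (G : Type*) [Group G] where
  X : Type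
  [measurableSpace : MeasurableSpace X]
  [standardBorelSpace : StandardBorelSpace X]
  μ : MeasureTheory.Measure X
  [isProbabilityMeasure : MeasureTheory.IsProbabilityMeasure μ]
  [mulAction : MulAction G X]
  measurePreserving : ∀ g : G, MeasureTheory.MeasurePreserving (fun x : X => g • x) μ μ
  free : ∀ᵐ x ∂μ, ∀ g : G, g ≠ 1 → g • x ≠ x

attribute [instance] FreePMPAction.measurableSpace FreePMPAction.standardBorelSpace
  FreePMPAction.isProbabilityMeasure FreePMPAction.mulAction

/-- `S` is a symmetric finite subset of `G` containing the identity. -/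
def IsSymmFinset {G : Type*} [Group G] (S : Finset G) : Prop :=
  1 ∈ S ∧ ∀ g ∈ S, g⁻¹ ∈ S

/-- `x` and `y` are connected by a path of length at most `C` in which each edge is, for some
`j`, an `F j`-edge with both endpoints in `V j`. The path is `p 0, …, p k`; the values of `p`
beyond `k` are irrelevant. -/
def ConnectedByPath {G X : Type*} [Group G] [MulAction G X] {n : ℕ}
    (F : Fin n → Finset G) (V : Fin n → Set X) (C : ℕ) (x y : X) : Prop :=
  ∃ k ≤ C, ∃ p : ℕ → X, p 0 = x ∧ p k = y ∧
    ∀ i < k, ∃ j : Fin n, (∃ s ∈ F j, p (i + 1) = s • p i) ∧ p i ∈ V j ∧ p (i + 1) ∈ V j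

/-- Property SC (sparse connectivity) for a class `𝒴` of free p.m.p. actions of `G`.
Only the values of `Υ` at nonempty finite sets are ever used. -/
def ClassPropertySC {G : Type*} [Group G] (𝒴 : Set (FreePMPAction G)) : Prop :=
  ∀ Υ : Finset G → ℝ≥0, ∃ S : Finset G, IsSymmFinset S ∧
    ∀ T : Finset G, IsSymmFinset T →
      ∃ (C n : ℕ) (F : Fin n → Finset G), (∀ j, IsSymmFinset (F j)) ∧
        ∀ A ∈ 𝒴, ∃ (W : Set A.X) (V : Fin n → Set A.X),
          MeasurableSet W ∧ (∀ j, MeasurableSet (V j)) ∧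
          ∑ j, (Υ (F j) : ℝ≥0∞) * A.μ (V j) ≤ 1 ∧
          (S : Set G) • W = Set.univ ∧
          ∀ w₁ ∈ W, ∀ w₂ ∈ W, (∃ g ∈ T, g • w₁ = w₂) → ConnectedByPath F V C w₁ w₂

/-- A group `G` has property SC if the class of all its free p.m.p. actions does. -/
def GroupPropertySC (G : Type*) [Group G] : Prop :=
  ClassPropertySC (Set.univ : Set (FreePMPAction G))

/-! Restrict each action of `G` to `N` and keep the set `W` that property SC of `N` provides. To
join `w₁` to `g • w₁` in `W`, travel inside the `N`-orbit of `w₁` to a point `w ∈ W` near a marker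
set `Z`, cross by one edge to `v ∈ W` near `g • w`, and return inside the `N`-orbit of `g • w₁`;
normality puts `v` in that orbit, at a displacement from a finite set fixed in advance. Only the
crossing needs a new vertex set, a bounded thickening of `Z`. As `N` is infinite, `exists_marker`
makes `Z` so small that this costs at most half the budget; doubling `Υ` on `N` confines the
`N`-paths to the other half. -/

/-- The restriction of a free p.m.p. action to a subgroup. -/
def FreePMPAction.restrict {G : Type*} [Group G] (A : FreePMPAction G) (N : Subgroup G) :
    FreePMPAction N where
  X := A.X
  μ := A.μ
  measurePreserving g := A.measurePreserving g
  free := by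
    filter_upwards [A.free] with x hx g hg
    exact hx g (by simpa using hg)

/-! ### Translates and Borel marker sets. -/

theorem FreePMPAction.measurableSet_smul {G : Type*} [Group G] (A : FreePMPAction G) (g : G)
    {B : Set A.X} (hB : MeasurableSet B) : MeasurableSet (g • B) := by
  rw [← Set.preimage_smul_inv]
  exact (A.measurePreserving g⁻¹).measurable hB

theorem FreePMPAction.measure_smul {G : Type*} [Group G] (A : FreePMPAction G) (g : G)
    {B : Set A.X} (hB : MeasurableSet B) : A.μ (g • B) = A.μ B := by
  rw [← Set.preimage_smul_inv]
  exact (A.measurePreserving g⁻¹).measure_preimage hB.nullMeasurableSet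

theorem FreePMPAction.measurableSet_finset_smul {G : Type*} [Group G] (A : FreePMPAction G)
    (K : Finset G) {B : Set A.X} (hB : MeasurableSet B) : MeasurableSet ((K : Set G) • B) := by
  rw [← Set.iUnion_smul_set]
  exact Finset.measurableSet_biUnion K fun g _ => A.measurableSet_smul g hB

theorem FreePMPAction.measure_finset_smul_le {G : Type*} [Group G] (A : FreePMPAction G)
    (K : Finset G) {B : Set A.X} (hB : MeasurableSet B) :
    A.μ ((K : Set G) • B) ≤ K.card * A.μ B := by
  rw [← Set.iUnion_smul_set]
  refine (MeasureTheory.measure_biUnion_finset_le K _).trans ?_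
  simp [A.measure_smul _ hB]

/-- Points moved by a finite set `D` are covered by countably many Borel sets, each disjoint from
its translates by `D`. -/
theorem FreePMPAction.exists_countable_independent_cover {G : Type*} [Group G]
    (A : FreePMPAction G) (D : Finset G) :
    ∃ B : ℕ → Set A.X, (∀ i, MeasurableSet (B i)) ∧ (∀ i, ∀ x ∈ B i, ∀ d ∈ D, d • x ∉ B i) ∧
      ∀ x : A.X, (∀ d ∈ D, d • x ≠ x) → ∃ i, x ∈ B i := by
  let := upgradeStandardBorel A.X
  have hne : (TopologicalSpace.countableBasis A.X ∪ {∅}).Nonempty := ⟨∅, by simp⟩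
  obtain ⟨U, hU⟩ := ((TopologicalSpace.countable_countableBasis A.X).union
    (Set.countable_singleton ∅)).exists_eq_range hne
  have hUo : ∀ i, IsOpen (U i) := by
    intro i
    have : U i ∈ TopologicalSpace.countableBasis A.X ∪ {∅} := hU ▸ Set.mem_range_self i
    rcases this with h | h
    · exact TopologicalSpace.isOpen_of_mem_countableBasis h
    · rw [Set.mem_singleton_iff.1 h]; exact isOpen_empty
  -- Keep the points of a basic open set that every `d ∈ D` throws out of it.
  refine ⟨fun i => U i ∩ ⋂ d ∈ D, (fun x => d • x) ⁻¹' (U i)ᶜ, fun i => ?_, ?_, ?_⟩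
  · exact (hUo i).measurableSet.inter (Finset.measurableSet_biInter D fun d _ =>
      (A.measurePreserving d).measurable (hUo i).measurableSet.compl)
  · intro i x hx d hd hdx
    have := Set.mem_iInter₂.1 hx.2 d hd
    exact this hdx.1
  · intro x hx
    have hfin : ((fun d : G => d • x) '' (D : Set G)).Finite := D.finite_toSet.image _
    obtain ⟨V, hV, hxV, hVs⟩ := (TopologicalSpace.isBasis_countableBasis A.X).exists_subset_of_mem_open
      (a := x) (u := ((fun d : G => d • x) '' (D : Set G))ᶜ)
      (by rintro ⟨d, hd, h⟩; exact hx d hd h) hfin.isClosed.isOpen_compl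
    obtain ⟨i, rfl⟩ : V ∈ Set.range U := hU ▸ Or.inl hV
    refine ⟨i, hxV, Set.mem_iInter₂.2 fun d hd h => hVs h ⟨d, hd, rfl⟩⟩

/-- A Borel maximal `D`-independent subset of the set of points moved by `D`. -/
theorem FreePMPAction.exists_maximal_independent {G : Type*} [Group G]
    (A : FreePMPAction G) (D : Finset G) (hD : ∀ d ∈ D, d⁻¹ ∈ D) :
    ∃ Z : Set A.X, MeasurableSet Z ∧ (∀ x ∈ Z, ∀ d ∈ D, d • x ∉ Z) ∧
      ∀ x : A.X, (∀ d ∈ D, d • x ≠ x) → x ∈ Z ∨ ∃ d ∈ D, d • x ∈ Z := by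
  obtain ⟨B, hBm, hBi, hBc⟩ := A.exists_countable_independent_cover D
  -- Greedy construction: stage `i` adds the points of `B i` not adjacent to earlier choices.
  let Z : ℕ → Set A.X := fun n => Nat.rec ∅ (fun i P => P ∪ (B i \ ((D : Set G) • P))) n
  have hZ : ∀ i, Z (i + 1) = Z i ∪ (B i \ ((D : Set G) • Z i)) := fun i => rfl
  have hmono : Monotone Z := monotone_nat_of_le_succ fun i => by
    rw [hZ]; exact Set.subset_union_left
  have hm : ∀ i, MeasurableSet (Z i) := by
    intro i
    induction i with
    | zero => exact MeasurableSet.empty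
    | succ i ih => rw [hZ]; exact ih.union ((hBm i).diff (A.measurableSet_finset_smul D ih))
  have hind : ∀ i, ∀ x ∈ Z i, ∀ d ∈ D, d • x ∉ Z i := by
    intro i
    induction i with
    | zero => intro x hx; exact hx.elim
    | succ i ih =>
      rw [hZ]
      rintro x (hx | hx) d hd (hy | hy)
      · exact ih x hx d hd hy
      · exact hy.2 (Set.smul_mem_smul hd hx)
      · exact hx.2 ⟨d⁻¹, hD d hd, d • x, hy, inv_smul_smul d x⟩
      · exact hBi i x hx.1 d hd hy.1
  refine ⟨⋃ i, Z i, MeasurableSet.iUnion hm, ?_, ?_⟩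
  · intro x hx d hd hy
    obtain ⟨i, hi⟩ := Set.mem_iUnion.1 hx
    obtain ⟨j, hj⟩ := Set.mem_iUnion.1 hy
    exact hind (max i j) x (hmono (le_max_left i j) hi) d hd (hmono (le_max_right i j) hj)
  · intro x hx
    obtain ⟨i, hi⟩ := hBc x hx
    by_cases h : x ∈ (D : Set G) • Z i
    · obtain ⟨d, hd, z, hz, rfl⟩ := h
      exact Or.inr ⟨d⁻¹, hD d hd, Set.mem_iUnion.2 ⟨i, by simpa using hz⟩⟩
    · exact Or.inl (Set.mem_iUnion.2 ⟨i + 1, Or.inr ⟨hi, h⟩⟩)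

/-- Marker lemma: for finite `E`, some Borel set `Z` of measure at most `1 / |E|` satisfies
`E⁻¹E Z = X`. -/
theorem FreePMPAction.exists_marker {G : Type*} [Group G] [DecidableEq G]
    (A : FreePMPAction G) (E : Finset G) :
    ∃ Z : Set A.X, MeasurableSet Z ∧ E.card * A.μ Z ≤ 1 ∧
      ∀ x : A.X, ∃ h ∈ insert 1 (E⁻¹ * E), h • x ∈ Z := by
  set D : Finset G := (E⁻¹ * E).erase 1
  have hD : ∀ d ∈ D, d⁻¹ ∈ D := by
    intro d hd
    obtain ⟨h1, h2⟩ := Finset.mem_erase.1 hd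
    refine Finset.mem_erase.2 ⟨by simpa using h1, ?_⟩
    have := Finset.inv_mem_inv h2
    simpa [mul_inv_rev] using this
  obtain ⟨Z, hZm, hZi, hZc⟩ := A.exists_maximal_independent D hD
  -- Adding this null set makes the covering hold at every point, not just almost everywhere.
  let P : Set A.X := ⋃ d ∈ D, {x | d • x = x}
  have hPm : MeasurableSet P := Finset.measurableSet_biUnion D fun d _ =>
    measurableSet_eq_fun (A.measurePreserving d).measurable measurable_id
  have hP0 : A.μ P = 0 := by
    refine MeasureTheory.measure_mono_null ?_ A.free
    intro x hx h
    obtain ⟨d, hd, hdx⟩ := Set.mem_iUnion₂.1 hx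
    exact h d (Finset.mem_erase.1 hd).1 hdx
  refine ⟨Z ∪ P, hZm.union hPm, ?_, ?_⟩
  · have hle : A.μ (Z ∪ P) ≤ A.μ Z := by
      simpa [hP0] using MeasureTheory.measure_union_le (μ := A.μ) Z P
    -- Independence makes the `|E|` translates of `Z` disjoint, whence the measure bound.
    have hdisj : (E : Set G).PairwiseDisjoint fun e => e • Z := by
      intro e he f hf hef
      refine Set.disjoint_left.2 ?_
      rintro _ ⟨z, hz, rfl⟩ ⟨y, hy, hyz⟩
      refine hZi z hz (f⁻¹ * e) (Finset.mem_erase.2 ⟨?_, ?_⟩) ?_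
      · intro h
        exact hef (inv_mul_eq_one.1 h).symm
      · exact Finset.mul_mem_mul (Finset.inv_mem_inv hf) he
      · have h : f • y = e • z := hyz
        rw [mul_smul, ← h, inv_smul_smul]
        exact hy
    calc (E.card : ℝ≥0∞) * A.μ (Z ∪ P) ≤ E.card * A.μ Z := by gcongr
      _ = ∑ e ∈ E, A.μ (e • Z) := by simp [A.measure_smul _ hZm]
      _ = A.μ (⋃ e ∈ E, e • Z) :=
        (MeasureTheory.measure_biUnion_finset hdisj fun e _ => A.measurableSet_smul e hZm).symm
      _ ≤ 1 := MeasureTheory.prob_le_one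
  · intro x
    by_cases hx : ∀ d ∈ D, d • x ≠ x
    · rcases hZc x hx with h | ⟨d, hd, h⟩
      · exact ⟨1, by simp, Or.inl (by simpa using h)⟩
      · exact ⟨d, Finset.mem_insert_of_mem (Finset.mem_of_mem_erase hd), Or.inl h⟩
    · push Not at hx
      obtain ⟨d, hd, h⟩ := hx
      exact ⟨1, by simp, Or.inr (Set.mem_iUnion₂.2 ⟨d, hd, by simpa using h⟩)⟩

/-! ### Paths and symmetric finite sets. -/

theorem ConnectedByPath.trans {G X : Type*} [Group G] [MulAction G X] {n : ℕ}
    {F : Fin n → Finset G} {V : Fin n → Set X} {C C' : ℕ} {x y z : X}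
    (hxy : ConnectedByPath F V C x y) (hyz : ConnectedByPath F V C' y z) :
    ConnectedByPath F V (C + C') x z := by
  obtain ⟨k, hk, p, hp0, hpk, hp⟩ := hxy
  obtain ⟨l, hl, q, hq0, hql, hq⟩ := hyz
  refine ⟨k + l, by omega, fun i => if i ≤ k then p i else q (i - k), by simpa using hp0, ?_, ?_⟩
  · rcases Nat.eq_zero_or_pos l with rfl | h
    · simp [hpk, ← hql, hq0]
    · have : ¬ k + l ≤ k := by omega
      simp [this, hql]
  · intro i hi
    rcases lt_trichotomy i k with h | h | h
    · simpa [h.le, Nat.succ_le_of_lt h] using hp i h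
    · subst h
      have := hq 0 (by omega)
      simpa [hpk, ← hq0] using this
    · have h1 : ¬ i ≤ k := by omega
      have h2 : ¬ i + 1 ≤ k := by omega
      have h3 : i + 1 - k = i - k + 1 := by omega
      simpa only [h1, h2, if_false, h3] using hq (i - k) (by omega)

theorem ConnectedByPath.of_edge {G X : Type*} [Group G] [MulAction G X] {n : ℕ}
    {F : Fin n → Finset G} {V : Fin n → Set X} {x : X} (j : Fin n) {s : G} (hs : s ∈ F j)
    (hx : x ∈ V j) (hy : s • x ∈ V j) : ConnectedByPath F V 1 x (s • x) := by
  refine ⟨1, le_rfl, fun i => if i = 0 then x else s • x, by simp, by simp, fun i hi => ?_⟩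
  obtain rfl : i = 0 := by omega
  exact ⟨j, ⟨s, hs, by simp⟩, by simpa using hx, by simpa using hy⟩

theorem exists_isSymmFinset_superset {G : Type*} [Group G] (A : Finset G) :
    ∃ B, IsSymmFinset B ∧ A ⊆ B := by
  classical
  refine ⟨insert 1 (A ∪ A⁻¹), ⟨by simp, fun g hg => ?_⟩, fun a ha => by simp [ha]⟩
  simp only [Finset.mem_insert, Finset.mem_union, Finset.mem_inv', inv_eq_one, inv_inv] at hg ⊢
  tauto

theorem IsSymmFinset.image_subtype {G : Type*} [Group G] [DecidableEq G] {N : Subgroup G}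
    {S : Finset N} (hS : IsSymmFinset S) : IsSymmFinset (S.image (Subtype.val : N → G)) := by
  refine ⟨Finset.mem_image.2 ⟨1, hS.1, rfl⟩, fun g hg => ?_⟩
  obtain ⟨s, hs, rfl⟩ := Finset.mem_image.1 hg
  exact Finset.mem_image.2 ⟨s⁻¹, hS.2 s hs, rfl⟩

theorem IsSymmFinset.mul_mul_self {G : Type*} [Group G] [DecidableEq G] {S T : Finset G}
    (hS : IsSymmFinset S) (hT : IsSymmFinset T) : IsSymmFinset (S * T * S) := by
  refine ⟨by simpa using Finset.mul_mem_mul (Finset.mul_mem_mul hS.1 hT.1) hS.1, fun g hg => ?_⟩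
  obtain ⟨a, ha, s, hs, rfl⟩ := Finset.mem_mul.1 hg
  obtain ⟨r, hr, t, ht, rfl⟩ := Finset.mem_mul.1 ha
  simpa [mul_assoc] using
    Finset.mul_mem_mul (Finset.mul_mem_mul (hS.2 s hs) (hT.2 t ht)) (hS.2 r hr)

/-! ### Passing from `N` to `G`. -/

theorem mainTheorem10 {G : Type*} [Group G] [Countable G]
    (N : Subgroup G) [N.Normal] [Infinite N]
    (hN : GroupPropertySC N) : GroupPropertySC G := by
  classical
  intro Υ
  obtain ⟨S₀, hS₀, hSC⟩ := hN fun F => 2 * Υ (F.image Subtype.val)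
  set S : Finset G := S₀.image Subtype.val
  have hS : IsSymmFinset S := hS₀.image_subtype
  refine ⟨S, hS, fun T hT => ?_⟩
  set K : Finset G := S * T * S
  have hK : IsSymmFinset K := hS.mul_mul_self hT
  -- With `|E| = m`, this gives `Υ K * μ (K • Z) ≤ 1 / 2`.
  obtain ⟨m, hm⟩ := exists_nat_ge (2 * Υ K * K.card)
  obtain ⟨E, hE⟩ := Infinite.exists_subset_card_eq N m
  set H : Finset N := insert 1 (E⁻¹ * E)
  -- `T₀` holds all displacements of the two `N`-legs: `s⁻¹ h` on the way out, `g h⁻¹ s g⁻¹ r` on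
  -- the way back. It does not depend on the action.
  obtain ⟨T₀, hT₀, hsub⟩ := exists_isSymmFinset_superset
    ((S₀ ×ˢ H).image (fun q => q.1⁻¹ * q.2) ∪
      (T ×ˢ H ×ˢ S₀ ×ˢ S₀).image fun q =>
        MulAut.conjNormal q.1 (q.2.1⁻¹ * q.2.2.1) * q.2.2.2)
  obtain ⟨C, n, F, hF, hA⟩ := hSC T₀ hT₀
  refine ⟨C + 1 + C, n + 1, Fin.cons K fun j => (F j).image Subtype.val, ?_, fun A _ => ?_⟩
  · intro j
    refine Fin.cases ?_ (fun j => ?_) j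
    · exact hK
    · exact (hF j).image_subtype
  obtain ⟨W, V, hW, hV, hsum, hSW, hpath⟩ := hA (A.restrict N) (Set.mem_univ _)
  obtain ⟨Z, hZm, hZμ, hZc⟩ := (A.restrict N).exists_marker E
  change Set A.X at W Z
  change Fin n → Set A.X at V
  change MeasurableSet (α := A.X) W at hW
  change ∀ j, MeasurableSet (α := A.X) (V j) at hV
  change MeasurableSet (α := A.X) Z at hZm
  change _ * A.μ Z ≤ 1 at hZμ
  change ∑ j, _ * A.μ (V j) ≤ 1 at hsum
  change ∀ x : A.X, ∃ h ∈ H, (h : G) • x ∈ Z at hZc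
  have hSW' : ∀ x : A.X, ∃ s ∈ S₀, ∃ w ∈ W, (s : G) • w = x := by
    intro x
    obtain ⟨s, hs, w, hw, h⟩ := hSW.ge (Set.mem_univ x)
    exact ⟨s, hs, w, hw, h⟩
  set V' : Fin (n + 1) → Set A.X := Fin.cons ((K : Set G) • Z) V with hV'
  have hN' : ∀ w₁ ∈ W, ∀ w₂ ∈ W, ∀ g ∈ T₀, (g : G) • w₁ = w₂ →
      ConnectedByPath (Fin.cons K fun j => (F j).image Subtype.val) V' C w₁ w₂ := by
    intro w₁ h₁ w₂ h₂ g hg hgw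
    obtain ⟨k, hk, p, hp0, hpk, hp⟩ := hpath w₁ h₁ w₂ h₂ ⟨g, hg, hgw⟩
    refine ⟨k, hk, p, hp0, hpk, fun i hi => ?_⟩
    obtain ⟨j, ⟨s, hs, hps⟩, h1, h2⟩ := hp i hi
    exact ⟨j.succ, ⟨s, Finset.mem_image_of_mem _ hs, hps⟩, h1, h2⟩
  refine ⟨W, V', hW, ?_, ?_, ?_, ?_⟩
  · intro j
    refine Fin.cases ?_ (fun j => ?_) j
    · exact A.measurableSet_finset_smul K hZm
    · exact hV j
  · rw [Fin.sum_univ_succ]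
    simp only [hV', Fin.cons_zero, Fin.cons_succ]
    have h1 : 2 * ((Υ K : ℝ≥0∞) * A.μ ((K : Set G) • Z)) ≤ 1 := by
      have hm' : (2 * Υ K * K.card : ℝ≥0∞) ≤ m := by exact_mod_cast hm
      calc 2 * ((Υ K : ℝ≥0∞) * A.μ ((K : Set G) • Z))
          ≤ 2 * ((Υ K : ℝ≥0∞) * (K.card * A.μ Z)) := by
            gcongr; exact A.measure_finset_smul_le K hZm
        _ = (2 * Υ K * K.card) * A.μ Z := by ring
        _ ≤ m * A.μ Z := by gcongr
        _ ≤ 1 := by rwa [← hE]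
    have h2 : 2 * ∑ j, (Υ ((F j).image Subtype.val) : ℝ≥0∞) * A.μ (V j) ≤ 1 := by
      rw [Finset.mul_sum]
      simpa [mul_assoc] using hsum
    have h3 := add_le_add h1 h2
    rw [← mul_add, one_add_one_eq_two] at h3
    exact (ENNReal.mul_le_mul_iff_right two_ne_zero ENNReal.ofNat_ne_top).1 (by simpa using h3)
  · refine Set.eq_univ_of_forall fun x => ?_
    obtain ⟨s, hs, w, hw, rfl⟩ := hSW' x
    exact Set.smul_mem_smul (Finset.mem_coe.2 (Finset.mem_image_of_mem _ hs)) hw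
  · rintro w₁ h₁ w₂ h₂ ⟨g, hg, rfl⟩
    obtain ⟨h, hh, hz⟩ := hZc w₁
    -- With `z = h • w₁ ∈ Z`: `w = s⁻¹ • z` and `v = r⁻¹ g s⁻¹ • z` both lie in `K • Z`.
    obtain ⟨s, hs, w, hw, hsw⟩ := hSW' ((h : G) • w₁)
    obtain ⟨r, hr, v, hv, hrv⟩ := hSW' (g • w)
    have hw_eq : w = (s : G)⁻¹ • (h : G) • w₁ := by rw [← hsw, inv_smul_smul]
    have hv_eq : v = ((r : G)⁻¹ * g) • w := by rw [mul_smul, ← hrv, inv_smul_smul]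
    have hsS : (s : G)⁻¹ ∈ S := hS.2 _ (Finset.mem_image_of_mem _ hs)
    have hrS : (r : G)⁻¹ ∈ S := hS.2 _ (Finset.mem_image_of_mem _ hr)
    have p₁ := hN' w₁ h₁ w hw (s⁻¹ * h)
      (hsub (Finset.mem_union_left _ (Finset.mem_image.2
        ⟨(s, h), Finset.mem_product.2 ⟨hs, hh⟩, rfl⟩)))
      (by rw [hw_eq, ← mul_smul]; rfl)
    have p₃ := hN' v hv (g • w₁) h₂ (MulAut.conjNormal g (h⁻¹ * s) * r)
      (hsub (Finset.mem_union_right _ (Finset.mem_image.2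
        ⟨(g, h, s, r), by simp [hg, hh, hs, hr], rfl⟩)))
      (by
        simp only [hv_eq, hw_eq, ← mul_smul, Subgroup.coe_mul, MulAut.conjNormal_apply,
          Subgroup.coe_inv]
        congr 1
        group)
    have p₂ : ConnectedByPath (Fin.cons K fun j => (F j).image Subtype.val) V' 1 w v := by
      have hK1 : (r : G)⁻¹ * g ∈ K := by
        simpa using Finset.mul_mem_mul (Finset.mul_mem_mul hrS hg) hS.1
      rw [hv_eq]
      refine ConnectedByPath.of_edge 0 hK1 ?_ ?_
      · rw [hw_eq]
        exact Set.smul_mem_smul (Finset.mem_coe.2 (by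
          simpa using Finset.mul_mem_mul (Finset.mul_mem_mul hS.1 hT.1) hsS)) hz
      · rw [hw_eq, ← mul_smul]
        exact Set.smul_mem_smul (Finset.mem_coe.2
          (Finset.mul_mem_mul (Finset.mul_mem_mul hrS hg) hsS)) hz
    exact (p₁.trans p₂).trans p₃
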